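/- Fix a set $X$ of atomic concepts and a set $R$ of roles with a distinguished role $\mathtt{id}\in R$. **$\mathcal{ALC}$.** Formulas: $C ::= \top \mid A \mid C\sqcap C \mid \lnot C \mid \exists\rho.C$ ($A\in X$, $\rho\in R$), with the usual semantics in interpretations $\mathcal I=(J,c,r)$, $c:X\to\wp(J)$, $r:R\to\wp(J\times J)$. The interpretation is *functional* (an $\mathcal{ALC}_1$ interpretation) if for all $\rho\in R$ and $j\in J$ there is exactly one $k$ with $(j,k)\in r(\rho)$. **ADL.** Formulas: $\alpha ::= \top\mid\bot\mid A\mid(\alpha\,?\,\alpha:\alpha)\mid(\alpha\mid\alpha)_\rho$. An *aleatoric structure* $\mathcal B=(I,r,\ell)$ has a set $I$, for all $\rho\in R$ and $i\in I$ a (discrete) probability distribution $\rho(i,\cdot)$ on $I$, and likelihoods $\ell(i,A)\in[0,1]$. It is an *aleatoric belief model* if moreover $\mathtt{id}(i,j)>0$ implies $\mathtt{id}(j,k)=\mathtt{id}(i,k)$ for all $i,j,k\in I$. Put $\mathcal B_i(\top)=1$, $\mathcal B_i(\bot)=0$, $\mathcal B_i(A)=\ell(i,A)$, $\mathcal B_i(\alpha\,?\,\beta:\gamma)=\mathcal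 B_i(\alpha)\mathcal B_i(\beta)+(1-\mathcal B_i(\alpha))\mathcal B_i(\gamma)$ and $$\mathcal B_i((\alpha\mid\beta)_\rho)=\frac{\sum_{j}\rho(i,j)\mathcal B_j(\alpha)\mathcal B_j(\beta)}{\sum_{j}\rho(i,j)\mathcal B_j(\beta)}\ \text{ if } \sum_j\rho(i,j)\mathcal B_j(\beta)>0,\qquad \mathcal B_i((\alpha\mid\beta)_\rho)=1\ \text{ otherwise.}$$ A functional interpretation $\mathcal I$ is read as the aleatoric structure $\mathcal B^{\mathcal I}$ on the same individuals with $\ell(j,A)=1$ if $j\in c(A)$ and $0$ otherwise, and with $\rho(j,\cdot)$ concentrated on the unique $\rho$-successor of $j$. An ADL formula $\alpha'$ is *logically equivalent* to an $\mathcal{ALC}$ formula $\alpha$ if for every functional interpretation $\mathcal I$ and individual $j$: $\mathcal I_j\models\alpha$ if and only if $\mathcal B^{\mathcal I}_j(\alpha')=1$. **Samplings.** Let $\mathcal B_i$ be a pointed aleatoric belief model. Let $W_i$ be the set of words $i\,\rho_1y_1\,\rho_2y_2\cdots\rho_ny_n$ ($n\ge 0$, $\rho_k\in R$, $y_k\in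 I$), and write $\mathrm{last}(w)\in I$ for the last letter of $w$. A *sampling* of $\mathcal B_i$ is a functional interpretation with set of individuals $W_i$ such that the $\rho$-successor of each $w$ is $w\rho y$ for some $y$ with $\rho(\mathrm{last}(w),y)>0$, and $w\in c(A)$ implies $\ell(\mathrm{last}(w),A)>0$. Let $\Omega^{\mathcal B_i}$ be the set of all samplings, let $\mathcal F$ be the $\sigma$-algebra on it generated by the events "$w\in c(A)$" and "the $\rho$-successor of $w$ is $w\rho y$", and for an $\mathcal{ALC}$ formula $\beta$ let $\hat\beta\subseteq\Omega^{\mathcal B_i}$ be the set of samplings that satisfy $\beta$ at the one-letter word $i$. **Theorem.** To every $\mathcal{ALC}$ formula $\alpha$ one can assign an ADL formula $\alpha^*$, depending only on $\alpha$ and logically equivalent to $\alpha$, such that for every pointed aleatoric belief model $\mathcal B_i$ there is a probability measure $P^{\mathcal B_i}$ on $(\Omega^{\mathcal B_i},\mathcal F)$ with the following properties. 1. $P^{\mathcal B_i}$ is the law of independent rolls of all dice of $\mathcal B_i$: for all finite sets $S\subseteq W_i\times X$ and $T\subseteq W_i\times R$, all $S'\subseteq S$ and all $y:T\to I$, the probability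 that for every $(w,A)\in S$ one has $w\in c(A)$ if and only if $(w,A)\in S'$, and that for every $(w,\rho)\in T$ the $\rho$-successor of $w$ is $w\,\rho\,y(w,\rho)$, equals $$\prod_{(w,A)\in S'}\ell(\mathrm{last}(w),A)\prod_{(w,A)\in S\setminus S'}\bigl(1-\ell(\mathrm{last}(w),A)\bigr)\prod_{(w,\rho)\in T}\rho\bigl(\mathrm{last}(w),y(w,\rho)\bigr).$$ 2. $\hat\beta\in\mathcal F$ for every $\mathcal{ALC}$ formula $\beta$. 3. $P^{\mathcal B_i}(\hat\alpha)=\mathcal B_i(\alpha^*)$ for every $\mathcal{ALC}$ formula $\alpha$. -/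

import Mathlib

open MeasureTheory

/-- Concepts (formulas) of the description logic ALC over atomic concepts `X` and roles `R`. -/
inductive ALC (X R : Type*) where
  | top : ALC X R
  | atom : X → ALC X R
  | inf : ALC X R → ALC X R → ALC X R
  | neg : ALC X R → ALC X R
  | ex : R → ALC X R → ALC X R

/-- Formulas of aleatoric description logic: always, never, atomic concepts,
if-then-else `(α ? β : γ)` and marginalisation `(α | β)_ρ`. -/
inductive ADL (X R : Type*) where
  | top : ADL X R
  | bot : ADL X R
  | atom : X → ADL X R
  | ite : ADL X R → ADL X R → ADL X R → ADL X R
  | cond : ADL X R → ADL X R → R → ADL X R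

/-- Interpretations of ALC on a set `I` of individuals. -/
structure Interp (X R I : Type*) where
  c : X → Set I
  r : R → Set (I × I)

namespace Interp

variable {X R I : Type*}

/-- The satisfaction relation of ALC at an individual. -/
def Sat (M : Interp X R I) : ALC X R → I → Prop
  | .top => fun _ => True
  | .atom A => fun i => i ∈ M.c A
  | .inf C D => fun i => M.Sat C i ∧ M.Sat D i
  | .neg C => fun i => ¬ M.Sat C i
  | .ex ρ C => fun i => ∃ j, (i, j) ∈ M.r ρ ∧ M.Sat C j

/-- Functional interpretations (interpretations of ALC₁): every individual has exactly one
successor for every role. -/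
def Functional (M : Interp X R I) : Prop :=
  ∀ (ρ : R) (i : I), ∃! j, (i, j) ∈ M.r ρ

end Interp

/-- Individuals `I`, a probability distribution `role ρ i` on `I` for every role and individual,
and a likelihood `lik i A` for every individual and atomic concept. -/
structure AleatoricStructure (X R I : Type*) where
  role : R → I → PMF I
  lik : I → X → unitInterval

/-- Aleatoric belief models: aleatoric structures in which the identity role `idr` satisfies
its additional constraint. -/
structure BeliefModel (X R : Type*) (idr : R) (I : Type*) extends AleatoricStructure X R I where
  id_role : ∀ i j k : I, 0 < role idr i j → role idr j k = role idr i k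

namespace AleatoricStructure

variable {X R I : Type*}

/-- The probability `𝓑_i(α)` that individual `i` satisfies the ADL formula `α`. -/
noncomputable def eval (B : AleatoricStructure X R I) : ADL X R → I → ℝ
  | .top => fun _ => 1
  | .bot => fun _ => 0
  | .atom A => fun i => (B.lik i A : ℝ)
  | .ite α β γ => fun i => B.eval α i * B.eval β i + (1 - B.eval α i) * B.eval γ i
  | .cond α β ρ => fun i =>
      open Classical in
      if 0 < ∑' j, (B.role ρ i j).toReal * B.eval β j then
        (∑' j, (B.role ρ i j).toReal * B.eval α j * B.eval β j) /
          (∑' j, (B.role ρ i j).toReal * B.eval β j)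
      else 1

end AleatoricStructure

open Classical in
/-- A functional interpretation seen as an aleatoric structure: all probabilities are `0` or `1`,
and the distribution of `ρ` at `i` is concentrated on the unique `ρ`-successor of `i`. -/
noncomputable def Interp.toAleatoric {X R I : Type*} (M : Interp X R I) (hM : M.Functional) :
    AleatoricStructure X R I where
  role ρ i := PMF.pure (hM ρ i).choose
  lik i A := if i ∈ M.c A then 1 else 0

/-- The words `i ρ₁ y₁ ρ₂ y₂ … ρₙ yₙ` with a fixed first letter `i`. The one-letter word `i` is
`start`, and `step w ρ y` is the word `w ρ y`. -/
inductive SampleWord (R I : Type*) where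
  | start : SampleWord R I
  | step : SampleWord R I → R → I → SampleWord R I

/-- The last letter of a word with first letter `i`. -/
def SampleWord.last {R I : Type*} (i : I) : SampleWord R I → I
  | .start => i
  | .step _ _ y => y

namespace AleatoricStructure

variable {X R I : Type*}

/-- Samplings of the pointed structure `𝓑_i`: functional interpretations on the words with first
letter `i`, where the `ρ`-successor of a word `w` with last letter `x` is `w ρ y` for some `y`
with `ρ(x,y) > 0`, and `w` satisfies only atomic concepts `A` with `ℓ(x,A) > 0`. -/
structure IsSampling (B : AleatoricStructure X R I) (i : I)
    (M : Interp X R (SampleWord R I)) : Prop where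
  functional : M.Functional
  role_succ : ∀ ρ w w', (w, w') ∈ M.r ρ → ∃ y, w' = w.step ρ y ∧ 0 < B.role ρ (w.last i) y
  concept : ∀ A w, w ∈ M.c A → 0 < (B.lik (w.last i) A : ℝ)

/-- The sample space `Ω` of the pointed structure `𝓑_i`. -/
def Sampling (B : AleatoricStructure X R I) (i : I) : Type _ :=
  {M : Interp X R (SampleWord R I) // B.IsSampling i M}

/-- The σ-algebra on `Ω` generated by the outcomes of the individual dice: whether the word `w`
satisfies `A`, and whether the `ρ`-successor of `w` is `w ρ y`. -/
instance samplingSigmaAlgebra (B : AleatoricStructure X R I) (i : I) :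
    MeasurableSpace (B.Sampling i) :=
  MeasurableSpace.generateFrom
    ({S | ∃ (w : SampleWord R I) (A : X), S = {M | w ∈ M.1.c A}} ∪
     {S | ∃ (w : SampleWord R I) (ρ : R) (y : I), S = {M | (w, w.step ρ y) ∈ M.1.r ρ}})

/-- The event `β̂`: the samplings that satisfy `β` at their initial individual. -/
def hat (B : AleatoricStructure X R I) (i : I) (β : ALC X R) : Set (B.Sampling i) :=
  {M | M.1.Sat β .start}

/-- The samplings in which finitely many dice have prescribed outcomes: for `(w, A)` in `s`, the
truth value of `A` at `w` is `b (w, A)`, and for `(w, ρ)` in `t`, the `ρ`-successor of `w` is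
`w ρ y(w, ρ)`. -/
def cylinder (B : AleatoricStructure X R I) (i : I)
    (s : Finset (SampleWord R I × X)) (b : SampleWord R I × X → Bool)
    (t : Finset (SampleWord R I × R)) (y : SampleWord R I × R → I) : Set (B.Sampling i) :=
  {M | (∀ d ∈ s, (d.1 ∈ M.1.c d.2 ↔ b d = true)) ∧
       (∀ d ∈ t, (d.1, d.1.step d.2 (y d)) ∈ M.1.r d.2)}

/-- `P` is the law of a sampling of `𝓑_i`: all dice are rolled independently, at a word with last
letter `x` the die of the atomic concept `A` shows `true` with probability `ℓ(x,A)`, and the die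
of the role `ρ` shows `y` with probability `ρ(x,y)`. -/
def IsSamplingLaw (B : AleatoricStructure X R I) (i : I) (P : Measure (B.Sampling i)) : Prop :=
  ∀ (s : Finset (SampleWord R I × X)) (b : SampleWord R I × X → Bool)
    (t : Finset (SampleWord R I × R)) (y : SampleWord R I × R → I),
    P.real (B.cylinder i s b t y) =
      (∏ d ∈ s, if b d then (B.lik (d.1.last i) d.2 : ℝ) else 1 - B.lik (d.1.last i) d.2) *
      ∏ d ∈ t, (B.role d.2 (d.1.last i) (y d)).toReal

end AleatoricStructure

/-!
In the random interpretation obtained by rolling all dice, the truth value of a concept at an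
individual is decided by a decision tree which rolls the dice of that individual one after the
other. The die of an atomic concept `A` is the ADL query `(A ? _ : _)`. The die of a role `ρ` may be
queried only once, since a second query would be an independent roll. On the event that exactly a
given set of the constituents `∃ρ.C` holds, the concept reduces to one without `ρ`; so one flips,
for each of these events, a coin with the probability of the reduct, and then queries by a single
roll of `ρ` the concept `E` of those successors whose truth values select a coin that came up true.
The dice of different letters, together with everything reached through them, are disjoint, so this
has the same probability as the original experiment, and `E` has smaller depth and is translated by
recursion. A functional interpretation is the deterministic case of the same argument.
-/

open ProbabilityTheory

namespace ALC

variable {X R : Type*}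

/-- The nesting depth of the existential quantifiers. -/
def depth : ALC X R → ℕ
  | .top => 0
  | .atom _ => 0
  | .inf C D => max C.depth D.depth
  | .neg C => C.depth
  | .ex _ C => C.depth + 1

/-- The concept `⊥`. -/
def bot : ALC X R := .neg .top

/-- The concept `(C ⊓ D) ⊔ (¬C ⊓ E)`, the Boolean counterpart of `ADL.ite`. -/
def ite (C D E : ALC X R) : ALC X R :=
  .inf (.neg (.inf C (.neg D))) (.neg (.inf (.neg C) (.neg E)))

/-- The maximal atomic or existential subformulas, of which a concept is a Boolean combination. -/
def constituents : ALC X R → List (ALC X R)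
  | .top => []
  | .atom A => [.atom A]
  | .inf C D => C.constituents ++ D.constituents
  | .neg C => C.constituents
  | .ex ρ C => [.ex ρ C]

/-- The atomic concepts and roles at the head of the constituents: they name the dice that the
truth value at an individual consults at this individual. -/
def letters : ALC X R → List (X ⊕ R)
  | .top => []
  | .atom A => [.inl A]
  | .inf C D => C.letters ++ D.letters
  | .neg C => C.letters
  | .ex ρ _ => [.inr ρ]

/-- The arguments `C` of the existential constituents `∃ρ.C`, for all roles `ρ` together. -/
def args : ALC X R → List (ALC X R)
  | .top => []
  | .atom _ => []
  | .inf C D => C.args ++ D.args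
  | .neg C => C.args
  | .ex _ C => [C]

open Classical in
/-- The result of replacing the constituent `φ` of a concept by `ψ`. -/
noncomputable def replace : ALC X R → ALC X R → ALC X R → ALC X R
  | .top, _, _ => .top
  | .atom A, φ, ψ => if .atom A = φ then ψ else .atom A
  | .inf C D, φ, ψ => .inf (C.replace φ ψ) (D.replace φ ψ)
  | .neg C, φ, ψ => .neg (C.replace φ ψ)
  | .ex ρ C, φ, ψ => if .ex ρ C = φ then ψ else .ex ρ C

theorem depth_ite (C D E : ALC X R) :
    (ite C D E).depth = max (max C.depth D.depth) (max C.depth E.depth) := rfl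

theorem inl_mem_letters {α : ALC X R} {A : X} :
    .inl A ∈ α.letters ↔ .atom A ∈ α.constituents := by
  induction α <;> simp_all [letters, constituents]

theorem inr_mem_letters {α : ALC X R} {ρ : R} :
    .inr ρ ∈ α.letters ↔ ∃ C, .ex ρ C ∈ α.constituents := by
  induction α <;> simp_all [letters, constituents, exists_or]

theorem mem_args {α C : ALC X R} {ρ : R} (h : .ex ρ C ∈ α.constituents) : C ∈ α.args := by
  induction α <;> grind [args, constituents]

theorem depth_lt_of_mem_args {α C : ALC X R} (h : C ∈ α.args) : C.depth < α.depth := by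
  induction α <;> grind [args, depth]

theorem depth_pos_of_inr_mem_letters {α : ALC X R} {ρ : R} (h : .inr ρ ∈ α.letters) :
    0 < α.depth :=
  have ⟨_, hC⟩ := inr_mem_letters.1 h
  (Nat.zero_le _).trans_lt (depth_lt_of_mem_args (mem_args hC))

theorem depth_replace_le {φ ψ : ALC X R} (hψ : ψ.depth = 0) (α : ALC X R) :
    (α.replace φ ψ).depth ≤ α.depth := by
  induction α with
  | inf _ _ hC hD => exact max_le_max hC hD
  | neg _ hC => exact hC
  | _ => grind [replace, depth]

theorem mem_constituents_replace {φ ψ χ : ALC X R} (hψ : ψ.constituents = []) {α : ALC X R}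
    (hχ : χ ∈ (α.replace φ ψ).constituents) : χ ∈ α.constituents ∧ χ ≠ φ := by
  induction α <;> grind [replace, constituents]

theorem letters_replace_subset {φ ψ : ALC X R} (hψ : ψ.constituents = []) (α : ALC X R) :
    (α.replace φ ψ).letters ⊆ α.letters := by
  rintro (A | ρ) hl
  · exact inl_mem_letters.2 (mem_constituents_replace hψ (inl_mem_letters.1 hl)).1
  · obtain ⟨C, hC⟩ := inr_mem_letters.1 hl
    exact inr_mem_letters.2 ⟨C, (mem_constituents_replace hψ hC).1⟩

theorem inl_notMem_letters_replace {A : X} {ψ : ALC X R} (hψ : ψ.constituents = [])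
    (α : ALC X R) : .inl A ∉ (α.replace (.atom A) ψ).letters :=
  fun h => (mem_constituents_replace hψ (inl_mem_letters.1 h)).2 rfl

theorem letters_replace_atom_subset {A : X} {ψ : ALC X R} (hψ : ψ.constituents = [])
    {α : ALC X R} {L : List (X ⊕ R)} (hα : α.letters ⊆ .inl A :: L) :
    (α.replace (.atom A) ψ).letters ⊆ L := fun _ hl =>
  (List.mem_cons.1 (hα (letters_replace_subset hψ α hl))).resolve_left fun hlA =>
    inl_notMem_letters_replace hψ α (hlA ▸ hl)

/-- The formula that rolls the die of `ρ` once to decide `α`, where `Cs` lists the concepts `C` for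
which `∃ρ.C` is a constituent of `α`. Two queries of `ρ` in ADL are two independent rolls, so the
roll is postponed: for every assignment of truth values to the `∃ρ.C`, a coin `k` of the concept to
which `α` reduces under it is flipped, and the outcomes are collected in a single concept `E` such
that `∃ρ.E` is the truth value of `α`. The continuation `K` receives `E`. -/
noncomputable def roleTree (k : ALC X R → ADL X R) (ρ : R) :
    List (ALC X R) → ALC X R → (ALC X R → ADL X R) → ADL X R
  | [], α, K => .ite (k α) (K .top) (K bot)
  | C :: Cs, α, K =>
    roleTree k ρ Cs (α.replace (.ex ρ C) .top) fun E =>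
      roleTree k ρ Cs (α.replace (.ex ρ C) bot) fun E' => K (ite C E E')

open Classical in
/-- The formula that decides `α` by rolling the dice named by the letters in `L` in turn, where `tr`
translates the concepts of smaller depth. Once no letters are left, the truth value of `α` is
constant and can be read off from any interpretation. -/
noncomputable def decisionTree (tr : ALC X R → ADL X R) : List (X ⊕ R) → ALC X R → ADL X R
  | [], α => if (⟨fun _ => ∅, fun _ => ∅⟩ : Interp X R Unit).Sat α () then .top else .bot
  | .inl A :: L, α =>
    .ite (.atom A) (decisionTree tr L (α.replace (.atom A) .top))
      (decisionTree tr L (α.replace (.atom A) bot))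
  | .inr ρ :: L, α => roleTree (decisionTree tr L) ρ α.args α fun E => .cond (tr E) .top ρ

/-- The ADL formula `α*` assigned to the ALC concept `α`. The case distinction only guards the
recursion: `decisionTree` calls `tr` on concepts of smaller depth. -/
noncomputable def toADL (α : ALC X R) : ADL X R :=
  decisionTree (fun D => if _h : D.depth < α.depth then toADL D else .top) α.letters α
termination_by α.depth

end ALC

namespace Interp

variable {X R W : Type*} {M : Interp X R W}

theorem sat_bot (w : W) : ¬ M.Sat ALC.bot w := fun h => h trivial

theorem sat_ite (C D E : ALC X R) (w : W) :
    M.Sat (C.ite D E) w ↔ M.Sat C w ∧ M.Sat D w ∨ ¬ M.Sat C w ∧ M.Sat E w := by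
  simp only [ALC.ite, Sat]
  tauto

theorem sat_replace {φ ψ : ALC X R} {w : W} (h : M.Sat φ w ↔ M.Sat ψ w) (α : ALC X R) :
    M.Sat (α.replace φ ψ) w ↔ M.Sat α w := by
  induction α with
  | top => rfl
  | inf C D hC hD => exact and_congr hC hD
  | neg C hC => exact not_congr hC
  | _ => grind [ALC.replace]

theorem sat_replace_top {φ : ALC X R} {w : W} (h : M.Sat φ w) (α : ALC X R) :
    M.Sat (α.replace φ .top) w ↔ M.Sat α w :=
  sat_replace (ψ := .top) (iff_of_true h trivial) α

theorem sat_replace_bot {φ : ALC X R} {w : W} (h : ¬ M.Sat φ w) (α : ALC X R) :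
    M.Sat (α.replace φ .bot) w ↔ M.Sat α w :=
  sat_replace (iff_of_false h (sat_bot w)) α

theorem sat_iff_of_letters_eq_nil {W' : Type*} (M' : Interp X R W') {α : ALC X R}
    (hα : α.letters = []) (w : W) (w' : W') : M.Sat α w ↔ M'.Sat α w' := by
  induction α with
  | top => rfl
  | inf C D hC hD =>
    have ⟨h, h'⟩ := List.append_eq_nil_iff.1 hα
    exact and_congr (hC h) (hD h')
  | neg C hC => exact not_congr (hC hα)
  | _ => cases hα

theorem Functional.exists_succ (hM : M.Functional) (ρ : R) (w : W) :
    ∃ v, ∀ C : ALC X R, M.Sat (.ex ρ C) w ↔ M.Sat C v := by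
  obtain ⟨v, hv, huniq⟩ := hM ρ w
  exact ⟨v, fun C => ⟨fun ⟨u, hu, hC⟩ => huniq u hu ▸ hC, fun hC => ⟨v, hv, hC⟩⟩⟩

theorem Functional.sat_ex_top (hM : M.Functional) (ρ : R) (w : W) : M.Sat (.ex ρ .top) w :=
  have ⟨_, hv⟩ := hM.exists_succ ρ w
  (hv .top).2 trivial

theorem Functional.sat_ex_inf (hM : M.Functional) (ρ : R) (C D : ALC X R) (w : W) :
    M.Sat (.ex ρ (.inf C D)) w ↔ M.Sat (.ex ρ C) w ∧ M.Sat (.ex ρ D) w := by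
  obtain ⟨v, hv⟩ := hM.exists_succ ρ w
  rw [hv, hv, hv, Sat]

theorem Functional.sat_ex_neg (hM : M.Functional) (ρ : R) (C : ALC X R) (w : W) :
    M.Sat (.ex ρ (.neg C)) w ↔ ¬ M.Sat (.ex ρ C) w := by
  obtain ⟨v, hv⟩ := hM.exists_succ ρ w
  rw [hv, hv, Sat]

theorem Functional.sat_ex_ite (hM : M.Functional) (ρ : R) (C D E : ALC X R) (w : W) :
    M.Sat (.ex ρ (C.ite D E)) w ↔
      M.Sat (.ex ρ C) w ∧ M.Sat (.ex ρ D) w ∨ ¬ M.Sat (.ex ρ C) w ∧ M.Sat (.ex ρ E) w := by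
  obtain ⟨v, hv⟩ := hM.exists_succ ρ w
  rw [hv, hv, hv, hv, sat_ite]

end Interp

section RandomReading

variable {X R I W Ω : Type*} [MeasurableSpace Ω]

/-- The probability that the random interpretation `M` satisfies `α` at `w`. -/
noncomputable def satProb (P : Measure Ω) (M : Ω → Interp X R W) (α : ALC X R) (w : W) : ℝ :=
  P.real {ω | (M ω).Sat α w}

/-- The random interpretation `M` reads the aleatoric structure `B` by independent rolls: an
individual `w` of `M` stands for the individual `last w` of `B`, and a roll `y` of the die of `ρ`
at `w` leads to `succ w ρ y`. This abstracts what the translation needs from samplings of a belief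
model and from the deterministic reading of a functional interpretation. -/
structure IsRandomReading (B : AleatoricStructure X R I) (last : W → I) (succ : W → R → I → W)
    (P : Measure Ω) (M : Ω → Interp X R W) : Prop where
  functional : ∀ ω, (M ω).Functional
  measurableSet_sat : ∀ α w, MeasurableSet {ω | (M ω).Sat α w}
  last_succ : ∀ w ρ y, last (succ w ρ y) = y
  satProb_atom : ∀ A w, satProb P M (.atom A) w = B.lik (last w) A
  satProb_ex : ∀ ρ C w, satProb P M (.ex ρ C) w =
    ∑' y, (B.role ρ (last w) y).toReal * satProb P M C (succ w ρ y)
  satProb_inf : ∀ α β w, α.letters.Disjoint β.letters →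
    satProb P M (.inf α β) w = satProb P M α w * satProb P M β w

theorem satProb_congr {P : Measure Ω} {M : Ω → Interp X R W} {α β : ALC X R} {w : W}
    (h : ∀ ω, (M ω).Sat α w ↔ (M ω).Sat β w) : satProb P M α w = satProb P M β w := by
  simp only [satProb, h]

theorem satProb_eq_zero {P : Measure Ω} {M : Ω → Interp X R W} {α : ALC X R} {w : W}
    (h : ∀ ω, ¬ (M ω).Sat α w) : satProb P M α w = 0 := by
  simp [satProb, h]

theorem satProb_eq_one {P : Measure Ω} [IsProbabilityMeasure P] {M : Ω → Interp X R W}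
    {α : ALC X R} {w : W} (h : ∀ ω, (M ω).Sat α w) : satProb P M α w = 1 := by
  simp [satProb, h]

theorem AleatoricStructure.eval_cond_top (B : AleatoricStructure X R I) (α : ADL X R) (ρ : R)
    (i : I) : B.eval (.cond α .top ρ) i = ∑' j, (B.role ρ i j).toReal * B.eval α j := by
  have htotal : ∑' j, (B.role ρ i j).toReal = 1 := by
    rw [← ENNReal.tsum_toReal_eq (PMF.apply_ne_top _), PMF.tsum_coe, ENNReal.toReal_one]
  simp [AleatoricStructure.eval, htotal]

namespace IsRandomReading

open Interp

variable {B : AleatoricStructure X R I} {last : W → I} {succ : W → R → I → W} {P : Measure Ω}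
  {M : Ω → Interp X R W}

theorem satProb_eq_add [IsFiniteMeasure P] (h : IsRandomReading B last succ P M)
    {α β γ φ : ALC X R} {w : W} (hβ : ∀ ω, (M ω).Sat β w ↔ (M ω).Sat α w ∧ (M ω).Sat φ w)
    (hγ : ∀ ω, (M ω).Sat γ w ↔ (M ω).Sat α w ∧ ¬ (M ω).Sat φ w) :
    satProb P M α w = satProb P M β w + satProb P M γ w := by
  simp only [satProb, hβ, hγ]
  exact (measureReal_inter_add_sdiff (ht := h.measurableSet_sat φ w) (h := measure_ne_top _ _)).symm

variable [IsProbabilityMeasure P]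

theorem satProb_neg (h : IsRandomReading B last succ P M) (α : ALC X R) (w : W) :
    satProb P M (.neg α) w = 1 - satProb P M α w := by
  have htop : satProb P M .top w = 1 := satProb_eq_one fun _ => trivial
  have hadd : satProb P M .top w = satProb P M α w + satProb P M (.neg α) w :=
    h.satProb_eq_add (φ := α) (by simp [Sat]) (by simp [Sat])
  linarith

theorem satProb_eq_replace_atom (h : IsRandomReading B last succ P M) (α : ALC X R) (A : X)
    (w : W) : satProb P M α w =
      B.lik (last w) A * satProb P M (α.replace (.atom A) .top) w +
        (1 - B.lik (last w) A) * satProb P M (α.replace (.atom A) .bot) w := by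
  have hsplit : satProb P M α w =
      satProb P M (.inf (.atom A) (α.replace (.atom A) .top)) w +
        satProb P M (.inf (.neg (.atom A)) (α.replace (.atom A) .bot)) w := by
    refine h.satProb_eq_add (φ := .atom A) (fun ω => ?_) fun ω => ?_
    · exact (and_congr_right fun hA => sat_replace_top hA α).trans and_comm
    · exact (and_congr_right fun hA => sat_replace_bot hA α).trans and_comm
  have hdisj : ∀ ψ : ALC X R, ψ.constituents = [] →
      [.inl A].Disjoint (α.replace (.atom A) ψ).letters := fun ψ hψ =>
    List.singleton_disjoint.2 (ALC.inl_notMem_letters_replace hψ α)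
  rw [hsplit, h.satProb_inf (.atom A) _ w (hdisj .top rfl),
    h.satProb_inf (.neg (.atom A)) _ w (hdisj .bot rfl), h.satProb_neg, h.satProb_atom]

theorem satProb_ex_inf_ite (h : IsRandomReading B last succ P M) (ρ : R) (D C E E' : ALC X R)
    (w : W) : satProb P M (.ex ρ (.inf D (C.ite E E'))) w =
      satProb P M (.ex ρ (.inf (.inf D C) E)) w +
        satProb P M (.ex ρ (.inf (.inf D (.neg C)) E')) w := by
  refine h.satProb_eq_add (φ := .ex ρ C) (fun ω => ?_) fun ω => ?_ <;>
  · simp only [(h.functional ω).sat_ex_inf, (h.functional ω).sat_ex_neg,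
      (h.functional ω).sat_ex_ite]
    tauto

theorem satProb_ex_inf_eq_replace (h : IsRandomReading B last succ P M) (ρ : R)
    (D C α : ALC X R) (w : W) : satProb P M (.inf (.ex ρ D) α) w =
      satProb P M (.inf (.ex ρ (.inf D C)) (α.replace (.ex ρ C) .top)) w +
        satProb P M (.inf (.ex ρ (.inf D (.neg C))) (α.replace (.ex ρ C) .bot)) w := by
  refine h.satProb_eq_add (φ := .ex ρ C) (fun ω => ?_) fun ω => ?_
  · have hα : (M ω).Sat (.ex ρ C) w → _ := fun hC => sat_replace_top hC α
    change (M ω).Sat (.ex ρ (.inf D C)) w ∧ _ ↔ (_ ∧ _) ∧ _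
    rw [(h.functional ω).sat_ex_inf]
    tauto
  · have hα : ¬ (M ω).Sat (.ex ρ C) w → _ := fun hC => sat_replace_bot hC α
    change (M ω).Sat (.ex ρ (.inf D (.neg C))) w ∧ _ ↔ (_ ∧ _) ∧ _
    rw [(h.functional ω).sat_ex_inf, (h.functional ω).sat_ex_neg]
    tauto

theorem eval_roleTree (h : IsRandomReading B last succ P M) {n : ℕ} (hn : 0 < n)
    {k : ALC X R → ADL X R} {ρ : R} {L : List (X ⊕ R)} {w : W}
    (hk : ∀ β : ALC X R, β.depth ≤ n → β.letters ⊆ L →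
      B.eval (k β) (last w) = satProb P M β w)
    {Cs : List (ALC X R)} (hCs : ∀ C ∈ Cs, C.depth < n) {α D : ALC X R} (hαn : α.depth ≤ n)
    (hαL : α.letters ⊆ .inr ρ :: L) (hαCs : ∀ C, .ex ρ C ∈ α.constituents → C ∈ Cs)
    {K : ALC X R → ADL X R} {c : ℝ} (hK : ∀ E : ALC X R, E.depth < n →
      B.eval (K E) (last w) = c + satProb P M (.ex ρ (.inf D E)) w) :
    B.eval (ALC.roleTree k ρ Cs α K) (last w) = c + satProb P M (.inf (.ex ρ D) α) w := by
  induction Cs generalizing α K D c with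
  | nil =>
    have hρ : .inr ρ ∉ α.letters := fun hρ =>
      have ⟨C, hC⟩ := ALC.inr_mem_letters.1 hρ
      absurd (hαCs C hC) List.not_mem_nil
    have hkα : B.eval (k α) (last w) = satProb P M α w :=
      hk α hαn fun l hl => (List.mem_cons.1 (hαL hl)).resolve_left fun hlρ => hρ (hlρ ▸ hl)
    have htop : satProb P M (.ex ρ (.inf D .top)) w = satProb P M (.ex ρ D) w :=
      satProb_congr fun ω => by simp [Sat]
    have hbot : satProb P M (.ex ρ (.inf D .bot)) w = 0 :=
      satProb_eq_zero fun ω => by simp [Sat, sat_bot]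
    rw [h.satProb_inf (.ex ρ D) α w (List.singleton_disjoint.2 hρ)]
    simp only [ALC.roleTree, AleatoricStructure.eval, hkα, hK .top hn, hK .bot hn, htop, hbot]
    ring
  | cons C Cs ih =>
    rw [List.forall_mem_cons] at hCs
    have ih' : ∀ ψ : ALC X R, ψ.depth = 0 → ψ.constituents = [] →
        ∀ {K : ALC X R → ADL X R} {D : ALC X R} {c : ℝ}, (∀ E : ALC X R, E.depth < n →
          B.eval (K E) (last w) = c + satProb P M (.ex ρ (.inf D E)) w) →
        B.eval (ALC.roleTree k ρ Cs (α.replace (.ex ρ C) ψ) K) (last w) =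
          c + satProb P M (.inf (.ex ρ D) (α.replace (.ex ρ C) ψ)) w :=
      fun ψ hψ hψ' => ih hCs.2 ((ALC.depth_replace_le hψ α).trans hαn)
        (List.Subset.trans (ALC.letters_replace_subset hψ' α) hαL) fun C' hC' => by
          have ⟨hmem, hne⟩ := ALC.mem_constituents_replace hψ' hC'
          exact (List.mem_cons.1 (hαCs C' hmem)).resolve_left fun hC'C => hne (hC'C ▸ rfl)
    rw [h.satProb_ex_inf_eq_replace ρ D C α w, ALC.roleTree, add_comm (satProb _ _ _ w),
      ← add_assoc]
    refine ih' .top rfl rfl fun E hE => ?_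
    rw [add_right_comm]
    refine ih' .bot rfl rfl fun E' hE' => ?_
    rw [hK _ (by simp [ALC.depth_ite, hCs.1, hE, hE']), h.satProb_ex_inf_ite, add_assoc]

theorem eval_decisionTree (h : IsRandomReading B last succ P M) {n : ℕ}
    {tr : ALC X R → ADL X R}
    (htr : ∀ D : ALC X R, D.depth < n → ∀ w, B.eval (tr D) (last w) = satProb P M D w)
    {L : List (X ⊕ R)} (hL : ∀ ρ, .inr ρ ∈ L → 0 < n) {α : ALC X R} (hαn : α.depth ≤ n)
    (hαL : α.letters ⊆ L) (w : W) :
    B.eval (ALC.decisionTree tr L α) (last w) = satProb P M α w := by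
  induction L generalizing α with
  | nil =>
    have hconst := fun ω => (M ω).sat_iff_of_letters_eq_nil ⟨fun _ => ∅, fun _ => ∅⟩
      (List.subset_nil.1 hαL) w ()
    rw [ALC.decisionTree]
    split_ifs with hα
    · exact (satProb_eq_one fun ω => (hconst ω).2 hα).symm
    · exact (satProb_eq_zero fun ω => mt (hconst ω).1 hα).symm
  | cons l L ih =>
    replace ih := @ih fun ρ hρ => hL ρ (List.mem_cons_of_mem l hρ)
    cases l with
    | inl A =>
      have ih' : ∀ ψ : ALC X R, ψ.depth = 0 → ψ.constituents = [] →
          B.eval (ALC.decisionTree tr L (α.replace (.atom A) ψ)) (last w) =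
            satProb P M (α.replace (.atom A) ψ) w := fun ψ hψ hψ' =>
        ih ((ALC.depth_replace_le hψ α).trans hαn) (ALC.letters_replace_atom_subset hψ' hαL)
      rw [h.satProb_eq_replace_atom α A w, ← ih' .top rfl rfl, ← ih' .bot rfl rfl]
      rfl
    | inr ρ =>
      have htop : satProb P M (.inf (.ex ρ .top) α) w = satProb P M α w :=
        satProb_congr fun ω => and_iff_right ((h.functional ω).sat_ex_top ρ w)
      rw [← htop, ← zero_add (satProb _ _ _ _)]
      refine h.eval_roleTree (hL ρ List.mem_cons_self) (fun β => ih)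
        (fun C hC => (ALC.depth_lt_of_mem_args hC).trans_le hαn) hαn hαL
        (fun C => ALC.mem_args) fun E hE => ?_
      have hE' : satProb P M (.ex ρ (.inf .top E)) w = satProb P M (.ex ρ E) w :=
        satProb_congr fun ω => by simp [Sat]
      rw [B.eval_cond_top, zero_add, hE', h.satProb_ex]
      refine tsum_congr fun y => ?_
      rw [← htr E hE, h.last_succ]

theorem eval_toADL (h : IsRandomReading B last succ P M) (α : ALC X R) (w : W) :
    B.eval α.toADL (last w) = satProb P M α w := by
  induction hn : α.depth using Nat.strong_induction_on generalizing α w with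
  | _ n ih =>
    subst hn
    rw [ALC.toADL]
    refine h.eval_decisionTree (fun D hD v => ?_)
      (fun ρ => ALC.depth_pos_of_inr_mem_letters) le_rfl (List.Subset.refl _) w
    rw [dif_pos hD]
    exact ih _ hD D v rfl

end IsRandomReading

end RandomReading

theorem Interp.Functional.isRandomReading {X R J : Type*} {M : Interp X R J} (hM : M.Functional) :
    IsRandomReading (M.toAleatoric hM) id (fun _ _ y => y) (Measure.dirac ()) (fun _ => M) where
  functional _ := hM
  measurableSet_sat _ _ := trivial
  last_succ _ _ _ := rfl
  satProb_atom A w := by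
    by_cases hA : w ∈ M.c A <;> simp [satProb, Sat, toAleatoric, hA]
  satProb_ex ρ C w := by
    obtain ⟨hj, huniq⟩ := (hM ρ w).choose_spec
    set j := (hM ρ w).choose with hjdef
    have : M.Sat (.ex ρ C) w ↔ M.Sat C j :=
      ⟨fun ⟨k, hk, hC⟩ => huniq k hk ▸ hC, fun hC => ⟨j, hj, hC⟩⟩
    rw [tsum_eq_single j]
    · simp [toAleatoric, satProb, ← hjdef, this]
    · intro k hk
      simp [toAleatoric, ← hjdef, hk]
  satProb_inf α β w _ := by
    by_cases hα : M.Sat α w <;> by_cases hβ : M.Sat β w <;> simp [satProb, Sat, hα, hβ]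

theorem Interp.Functional.sat_iff_eval_toADL {X R J : Type*} {M : Interp X R J}
    (hM : M.Functional) (α : ALC X R) (j : J) :
    M.Sat α j ↔ (M.toAleatoric hM).eval α.toADL j = 1 := by
  have heval : (M.toAleatoric hM).eval α.toADL j = satProb (.dirac ()) (fun _ => M) α j :=
    hM.isRandomReading.eval_toADL α j
  by_cases hα : M.Sat α j <;> simp [heval, satProb, hα]

namespace SampleWord

variable {X R I : Type*}

/-- The word `v` starts with the word `w`. -/
inductive Extends (w : SampleWord R I) : SampleWord R I → Prop
  | refl : Extends w w
  | step {v : SampleWord R I} (ρ : R) (y : I) : Extends w v → Extends w (v.step ρ y)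

/-- The number of roles in a word. -/
def length : SampleWord R I → ℕ
  | .start => 0
  | .step w _ _ => w.length + 1

theorem Extends.length_le {w v : SampleWord R I} (h : w.Extends v) : w.length ≤ v.length := by
  induction h with
  | refl => exact le_rfl
  | step ρ y _ ih => exact ih.trans (Nat.le_succ _)

theorem Extends.of_step {w v : SampleWord R I} {ρ : R} {y : I} (h : (w.step ρ y).Extends v) :
    w.Extends v := by
  induction h with
  | refl => exact .step _ _ .refl
  | step ρ y _ ih => exact .step _ _ ih

theorem not_extends_step (w : SampleWord R I) (ρ : R) (y : I) : ¬ (w.step ρ y).Extends w :=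
  fun h => (Nat.lt_succ_self _).not_ge h.length_le

theorem Extends.eq_of_length_eq {w w' v : SampleWord R I} (h : w.Extends v) (h' : w'.Extends v)
    (hl : w.length = w'.length) : w = w' := by
  induction h with
  | refl =>
    cases h' with
    | refl => rfl
    | step ρ y h' => exact absurd h'.length_le (hl ▸ (Nat.lt_succ_self _).not_ge)
  | step ρ y h ih =>
    cases h' with
    | refl => exact absurd h.length_le (hl ▸ (Nat.lt_succ_self _).not_ge)
    | step _ _ h' => exact ih h'

/-- The dice of a sampling: at every word, one for each atomic concept and one for each role. -/
abbrev Die (X R I : Type*) := (SampleWord R I × X) ⊕ (SampleWord R I × R)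

/-- The word at which a die is rolled. -/
def Die.word : Die X R I → SampleWord R I := Sum.elim Prod.fst Prod.fst

/-- The dice that decide the constituents with head `l` at the word `w`: the die of `l` at `w` and,
if `l` is a role, all dice behind it. -/
def branch (w : SampleWord R I) : X ⊕ R → Set (Die X R I)
  | .inl A => {.inl (w, A)}
  | .inr ρ => {d | d = .inr (w, ρ) ∨ ∃ y, (w.step ρ y).Extends (Die.word d)}

theorem extends_word_of_mem_branch {w : SampleWord R I} {l : X ⊕ R} {d : Die X R I}
    (hd : d ∈ w.branch l) : w.Extends (Die.word d) := by
  rcases l with A | ρ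
  · exact (Set.mem_singleton_iff.1 hd) ▸ .refl
  · rcases hd with rfl | ⟨y, hd⟩
    exacts [.refl, hd.of_step]

theorem disjoint_branch (w : SampleWord R I) {l k : X ⊕ R} (hlk : l ≠ k) :
    Disjoint (w.branch l) (w.branch k) := by
  rw [Set.disjoint_left]
  rcases l with A | ρ <;> rcases k with A' | σ
  · rintro _ rfl h
    grind [branch]
  · rintro _ rfl (h | ⟨y, h⟩)
    exacts [Sum.inl_ne_inr h, not_extends_step w σ y h]
  · rintro _ h rfl
    rcases h with h | ⟨y, h⟩
    exacts [Sum.inl_ne_inr h, not_extends_step w ρ y h]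
  · rintro d (rfl | ⟨y, h⟩) (h' | ⟨z, h'⟩)
    · grind
    · exact not_extends_step w σ z h'
    · subst h'
      exact not_extends_step w ρ y h
    · have := h.eq_of_length_eq h' rfl
      grind

end SampleWord

namespace AleatoricStructure

open SampleWord

variable {X R I : Type*} (B : AleatoricStructure X R I) (i : I)

/-- The event that a die has its favourable outcome: the atomic concept holds, or the role leads to
the individual prescribed by `y`. -/
def outcome (y : SampleWord R I × R → I) : Die X R I → Set (B.Sampling i)
  | .inl d => {M | d.1 ∈ M.1.c d.2}
  | .inr d => {M | (d.1, d.1.step d.2 (y d)) ∈ M.1.r d.2}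

/-- The σ-algebra generated by the dice in `S`. -/
abbrev diceAlgebra (S : Set (Die X R I)) : MeasurableSpace (B.Sampling i) :=
  ⨆ d ∈ S, MeasurableSpace.generateFrom (Set.range (B.outcome i · d))

variable {B i}

theorem isPiSystem_range_outcome (d : Die X R I) :
    IsPiSystem (Set.range (B.outcome i · d)) := by
  rintro _ ⟨y, rfl⟩ _ ⟨z, rfl⟩ ⟨M, hy, hz⟩
  rcases d with d | d
  · exact ⟨y, (Set.inter_self _).symm⟩
  · have hyz : y d = z d := by
      have := (M.2.functional d.2 d.1).unique hy hz
      grind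
    exact ⟨y, by simp [outcome, hyz]⟩

theorem measurableSet_outcome_diceAlgebra (y : SampleWord R I × R → I) {S : Set (Die X R I)}
    {d : Die X R I} (hd : d ∈ S) : MeasurableSet[B.diceAlgebra i S] (B.outcome i y d) :=
  le_biSup (fun d => MeasurableSpace.generateFrom (Set.range (B.outcome i · d))) hd _
    (MeasurableSpace.measurableSet_generateFrom ⟨y, rfl⟩)

theorem measurableSet_outcome (y : SampleWord R I × R → I) (d : Die X R I) :
    MeasurableSet (B.outcome i y d) := by
  refine MeasurableSpace.measurableSet_generateFrom ?_
  rcases d with ⟨w, A⟩ | ⟨w, ρ⟩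
  exacts [.inl ⟨w, A, rfl⟩, .inr ⟨w, ρ, y (w, ρ), rfl⟩]

theorem generateFrom_range_outcome_le (d : Die X R I) :
    MeasurableSpace.generateFrom (Set.range (B.outcome i · d)) ≤ B.samplingSigmaAlgebra i :=
  MeasurableSpace.generateFrom_le <| by
    rintro _ ⟨y, rfl⟩
    exact measurableSet_outcome y d

theorem diceAlgebra_le (S : Set (Die X R I)) : B.diceAlgebra i S ≤ B.samplingSigmaAlgebra i :=
  iSup₂_le fun d _ => generateFrom_range_outcome_le d

theorem setOf_sat_ex (ρ : R) (C : ALC X R) (w : SampleWord R I) :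
    {M : B.Sampling i | M.1.Sat (.ex ρ C) w} = ⋃ y ∈ (B.role ρ (w.last i)).support,
      B.outcome i (fun _ => y) (.inr (w, ρ)) ∩ {M | M.1.Sat C (w.step ρ y)} := by
  ext M
  simp only [Interp.Sat, outcome, Set.mem_ofPred_eq, Set.mem_iUnion, Set.mem_inter_iff, exists_prop]
  constructor
  · rintro ⟨v, hv, hC⟩
    obtain ⟨y, rfl, hy⟩ := M.2.role_succ ρ w v hv
    exact ⟨y, hy.ne', hv, hC⟩
  · rintro ⟨y, -, hv, hC⟩
    exact ⟨_, hv, hC⟩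

theorem measurableSet_sat_diceAlgebra (α : ALC X R) {w : SampleWord R I} {S : Set (Die X R I)}
    (hS : ∀ l ∈ α.letters, w.branch l ⊆ S) :
    MeasurableSet[B.diceAlgebra i S] {M : B.Sampling i | M.1.Sat α w} := by
  induction α generalizing w with
  | top => exact .univ
  | atom A => exact measurableSet_outcome_diceAlgebra (fun _ => i) (hS (.inl A) (.head _) rfl)
  | inf C D hC hD =>
    exact (hC fun l hl => hS l (List.mem_append_left _ hl)).inter
      (hD fun l hl => hS l (List.mem_append_right _ hl))
  | neg C hC => exact (hC hS).compl
  | ex ρ C hC =>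
    have hρ : w.branch (.inr ρ) ⊆ S := hS _ (.head _)
    rw [setOf_sat_ex]
    exact .biUnion (PMF.support_countable _) fun y _ =>
      (measurableSet_outcome_diceAlgebra _ (hρ (.inl rfl))).inter
        (hC fun l _ d hd => hρ (.inr ⟨y, extends_word_of_mem_branch hd⟩))

theorem measurableSet_sat (α : ALC X R) (w : SampleWord R I) :
    MeasurableSet {M : B.Sampling i | M.1.Sat α w} :=
  diceAlgebra_le _ _ (measurableSet_sat_diceAlgebra (S := .univ) α fun _ _ => Set.subset_univ _)

variable (B i) in
theorem measurableSet_hat (β : ALC X R) : MeasurableSet (B.hat i β) :=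
  measurableSet_sat β .start

namespace IsSamplingLaw

variable {P : Measure (B.Sampling i)}

theorem isProbabilityMeasure (hP : B.IsSamplingLaw i P) : IsProbabilityMeasure P := by
  have := hP ∅ (fun _ => true) ∅ (fun _ => i)
  have huniv : P.real .univ = 1 := by simpa [cylinder] using this
  exact ⟨by simpa [Measure.real, ENNReal.toReal_eq_one_iff] using huniv⟩

theorem real_outcome_inl (hP : B.IsSamplingLaw i P) (y : SampleWord R I × R → I)
    (d : SampleWord R I × X) : P.real (B.outcome i y (.inl d)) = B.lik (d.1.last i) d.2 := by
  simpa [cylinder, outcome] using hP {d} (fun _ => true) ∅ y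

theorem real_outcome_inr (hP : B.IsSamplingLaw i P) (y : SampleWord R I × R → I)
    (d : SampleWord R I × R) :
    P.real (B.outcome i y (.inr d)) = (B.role d.2 (d.1.last i) (y d)).toReal := by
  simpa [cylinder, outcome] using hP ∅ (fun _ => true) {d} y

theorem real_biInter_outcome (hP : B.IsSamplingLaw i P) (y : SampleWord R I × R → I)
    (s : Finset (Die X R I)) :
    P.real (⋂ d ∈ s, B.outcome i y d) = ∏ d ∈ s, P.real (B.outcome i y d) := by
  have hcyl : ⋂ d ∈ s, B.outcome i y d = B.cylinder i s.toLeft (fun _ => true) s.toRight y := by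
    ext M
    simp [cylinder, outcome, Sum.forall]
  rw [hcyl, hP, Finset.prod_sum_eq_prod_toLeft_mul_prod_toRight]
  simp [hP.real_outcome_inl, hP.real_outcome_inr]

theorem iIndep_die (hP : B.IsSamplingLaw i P) :
    iIndep (fun d => MeasurableSpace.generateFrom (Set.range (B.outcome i · d))) P := by
  have := hP.isProbabilityMeasure
  refine iIndepSets.iIndep generateFrom_range_outcome_le _ isPiSystem_range_outcome
    (fun _ => rfl) ((iIndepSets_iff _ _).2 fun s f hf => ?_)
  have : Nonempty I := ⟨i⟩
  choose! z hz using hf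
  let y : SampleWord R I × R → I := fun d => z (.inr d) d
  have hy : ∀ d ∈ s, B.outcome i y d = f d := fun d hd => by
    rw [← hz d hd]
    cases d <;> rfl
  rw [← Set.iInter₂_congr hy, ← Finset.prod_congr rfl fun d hd => congrArg P (hy d hd),
    ← ENNReal.toReal_eq_toReal_iff' (measure_ne_top _ _)
      (ENNReal.prod_ne_top fun _ _ => measure_ne_top _ _), ENNReal.toReal_prod]
  exact hP.real_biInter_outcome y s

theorem indep_diceAlgebra (hP : B.IsSamplingLaw i P) {S T : Set (Die X R I)}
    (hST : Disjoint S T) : Indep (B.diceAlgebra i S) (B.diceAlgebra i T) P :=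
  indep_iSup_of_disjoint generateFrom_range_outcome_le hP.iIndep_die hST

theorem real_sat_inf (hP : B.IsSamplingLaw i P) {α β : ALC X R} (w : SampleWord R I)
    (hαβ : α.letters.Disjoint β.letters) :
    P.real {M | M.1.Sat (.inf α β) w} =
      P.real {M | M.1.Sat α w} * P.real {M | M.1.Sat β w} := by
  have hdisj : Disjoint (⋃ l ∈ α.letters, w.branch l) (⋃ l ∈ β.letters, w.branch l) := by
    simp only [Set.disjoint_iUnion_left, Set.disjoint_iUnion_right]
    exact fun l hl k hk => disjoint_branch w fun hkl => hαβ hk (hkl ▸ hl)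
  have hindep := (Indep_iff _ _ _).1 (hP.indep_diceAlgebra hdisj) _ _
    (measurableSet_sat_diceAlgebra α fun l hl => Set.subset_biUnion_of_mem hl)
    (measurableSet_sat_diceAlgebra β fun l hl => Set.subset_biUnion_of_mem hl)
  exact (congrArg ENNReal.toReal hindep).trans ENNReal.toReal_mul

theorem measure_outcome_inter_sat_step (hP : B.IsSamplingLaw i P) (ρ : R) (C : ALC X R)
    (w : SampleWord R I) (y : I) :
    P (B.outcome i (fun _ => y) (.inr (w, ρ)) ∩ {M | M.1.Sat C (w.step ρ y)}) =
      B.role ρ (w.last i) y * P {M | M.1.Sat C (w.step ρ y)} := by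
  have := hP.isProbabilityMeasure
  have hdisj : Disjoint {.inr (w, ρ)} {d : Die X R I | (w.step ρ y).Extends (Die.word d)} :=
    Set.disjoint_singleton_left.2 (not_extends_step w ρ y)
  rw [(Indep_iff _ _ _).1 (hP.indep_diceAlgebra hdisj) _ _
    (measurableSet_outcome_diceAlgebra _ rfl)
    (measurableSet_sat_diceAlgebra C fun l _ d hd => extends_word_of_mem_branch hd)]
  congr 1
  rw [← ENNReal.toReal_eq_toReal_iff' (measure_ne_top _ _) (PMF.apply_ne_top _ _)]
  exact hP.real_outcome_inr _ _

theorem real_sat_ex (hP : B.IsSamplingLaw i P) (ρ : R) (C : ALC X R) (w : SampleWord R I) :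
    P.real {M | M.1.Sat (.ex ρ C) w} =
      ∑' y, (B.role ρ (w.last i) y).toReal * P.real {M | M.1.Sat C (w.step ρ y)} := by
  have := hP.isProbabilityMeasure
  have hdisj : (B.role ρ (w.last i)).support.PairwiseDisjoint fun y =>
      B.outcome i (fun _ => y) (.inr (w, ρ)) ∩ {M | M.1.Sat C (w.step ρ y)} := by
    refine fun y _ z _ hyz => Set.disjoint_left.2 fun M hy hz => hyz ?_
    have := (M.2.functional ρ w).unique hy.1 hz.1
    grind
  have hmeas : P {M | M.1.Sat (.ex ρ C) w} =
      ∑' y, B.role ρ (w.last i) y * P {M | M.1.Sat C (w.step ρ y)} := by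
    rw [setOf_sat_ex, measure_biUnion (PMF.support_countable _) hdisj fun y _ =>
      (measurableSet_outcome _ _).inter (measurableSet_sat C _)]
    simp only [hP.measure_outcome_inter_sat_step]
    exact tsum_subtype_eq_of_support_subset (f := fun y => _ * P {M | M.1.Sat C (w.step ρ y)})
      fun y hy => left_ne_zero_of_mul hy
  rw [Measure.real, hmeas, ENNReal.tsum_toReal_eq fun y =>
    ENNReal.mul_ne_top (PMF.apply_ne_top _ _) (measure_ne_top _ _)]
  simp only [ENNReal.toReal_mul, Measure.real]

theorem isRandomReading (hP : B.IsSamplingLaw i P) :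
    IsRandomReading B (SampleWord.last i) SampleWord.step P Subtype.val where
  functional M := M.2.functional
  measurableSet_sat := measurableSet_sat
  last_succ _ _ _ := rfl
  satProb_atom A w := hP.real_outcome_inl (fun _ => i) (w, A)
  satProb_ex := hP.real_sat_ex
  satProb_inf _ _ w := hP.real_sat_inf w

theorem real_hat (hP : B.IsSamplingLaw i P) (α : ALC X R) :
    P.real (B.hat i α) = B.eval α.toADL i :=
  have := hP.isProbabilityMeasure
  (hP.isRandomReading.eval_toADL α .start).symm

end IsSamplingLaw

end AleatoricStructure

section Rolls

variable {ι α : Type*}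

/-- The distribution `p` on the subtype of its possible values. -/
noncomputable def pmfOnSupport (p : PMF α) : PMF p.support :=
  ⟨fun a => p a, (hasSum_subtype_iff_of_support_subset subset_rfl).2 p.2⟩

/-- The law of independent random variables with distributions `p d`, restricted to the families of
possible values. -/
noncomputable def independentRolls [MeasurableSpace α] (p : ι → PMF α) :
    Measure (∀ d, (p d).support) :=
  Measure.infinitePi fun d => (pmfOnSupport (p d)).toMeasure

variable [MeasurableSpace α]

instance (p : ι → PMF α) : IsProbabilityMeasure (independentRolls p) :=
  inferInstanceAs (IsProbabilityMeasure (Measure.infinitePi _))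

variable [MeasurableSingletonClass α]

theorem toMeasure_pmfOnSupport_preimage (p : PMF α) (a : α) :
    (pmfOnSupport p).toMeasure (Subtype.val ⁻¹' {a}) = p a := by
  by_cases ha : a ∈ p.support
  · have : Subtype.val ⁻¹' {a} = {(⟨a, ha⟩ : p.support)} := by
      ext x
      simp [Subtype.ext_iff]
    rw [this, PMF.toMeasure_apply_singleton _ _ (measurableSet_singleton _)]
    rfl
  · have : Subtype.val ⁻¹' {a} = (∅ : Set p.support) :=
      Set.eq_empty_of_forall_notMem fun x hx => ha (hx ▸ x.2)
    rw [this, measure_empty, (p.apply_eq_zero_iff a).2 ha]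

theorem independentRolls_forall_eq (p : ι → PMF α) (s : Finset ι) (a : ι → α) :
    independentRolls p {ω | ∀ d ∈ s, ω d = a d} = ∏ d ∈ s, p d (a d) := by
  have hpi := Measure.infinitePi_pi (μ := fun d => (pmfOnSupport (p d)).toMeasure) (s := s)
    fun d _ => measurable_subtype_coe (measurableSet_singleton (a d))
  simp only [toMeasure_pmfOnSupport_preimage] at hpi
  exact hpi

end Rolls

namespace AleatoricStructure

variable {X R I : Type*} (B : AleatoricStructure X R I) (i : I)

/-- The distribution of the die of an atomic concept. -/
noncomputable def coin (d : SampleWord R I × X) : PMF Bool :=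
  (bernoulliMeasure true false (B.lik (d.1.last i) d.2)).toPMF

/-- The distribution of the die of a role. -/
noncomputable def successor (d : SampleWord R I × R) : PMF I :=
  B.role d.2 (d.1.last i)

theorem toReal_coin (d : SampleWord R I × X) (b : Bool) :
    (B.coin i d b).toReal =
      if b then (B.lik (d.1.last i) d.2 : ℝ) else 1 - B.lik (d.1.last i) d.2 := by
  cases b <;> simp [coin, Measure.toPMF_apply]

/-- The families of possible outcomes of all dice. -/
abbrev Rolls := (∀ d, (B.coin i d).support) × ∀ d, (B.successor i d).support

variable {B i}

/-- The interpretation determined by the outcomes of all dice. -/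
def Rolls.interp (ω : B.Rolls i) : Interp X R (SampleWord R I) where
  c A := {w | ω.1 (w, A) = true}
  r ρ := {v | v.2 = v.1.step ρ (ω.2 (v.1, ρ))}

theorem Rolls.step_mem_r_iff {ω : B.Rolls i} {w : SampleWord R I} {ρ : R} {y : I} :
    (w, w.step ρ y) ∈ ω.interp.r ρ ↔ ω.2 (w, ρ) = y := by
  simp only [interp, Set.mem_ofPred_eq, SampleWord.step.injEq, true_and]
  exact eq_comm

theorem Rolls.isSampling (ω : B.Rolls i) : B.IsSampling i ω.interp where
  functional ρ w := by simp [interp]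
  role_succ ρ w _ h := ⟨_, h, (PMF.apply_pos_iff _ _).2 (ω.2 (w, ρ)).2⟩
  concept A w h := by
    have hpos := ENNReal.toReal_pos (ω.1 (w, A)).2 (PMF.apply_ne_top _ _)
    rwa [toReal_coin, if_pos (by simpa [interp] using h)] at hpos

/-- The outcomes of all dice as a sampling. -/
def Rolls.sampling (ω : B.Rolls i) : B.Sampling i := ⟨ω.interp, ω.isSampling⟩

theorem Rolls.measurable_sampling [MeasurableSpace I] [MeasurableSingletonClass I] :
    Measurable (Rolls.sampling : B.Rolls i → B.Sampling i) := by
  refine measurable_generateFrom ?_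
  rintro _ (⟨w, A, rfl⟩ | ⟨w, ρ, y, rfl⟩)
  · exact (measurable_subtype_coe.comp ((measurable_pi_apply (w, A)).comp measurable_fst))
      (measurableSet_singleton true)
  · have : Rolls.sampling ⁻¹' {M : B.Sampling i | (w, w.step ρ y) ∈ M.1.r ρ} =
        {ω | ω.2 (w, ρ) = y} := Set.ext fun _ => step_mem_r_iff
    rw [this]
    exact (measurable_subtype_coe.comp ((measurable_pi_apply (w, ρ)).comp measurable_snd))
      (measurableSet_singleton y)

theorem Rolls.preimage_cylinder (s : Finset (SampleWord R I × X)) (b : SampleWord R I × X → Bool)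
    (t : Finset (SampleWord R I × R)) (y : SampleWord R I × R → I) :
    Rolls.sampling ⁻¹' B.cylinder i s b t y =
      {ω | ∀ d ∈ s, ω d = b d} ×ˢ {ω | ∀ d ∈ t, ω d = y d} := by
  ext ω
  exact and_congr (forall₂_congr fun _ _ => Bool.coe_iff_coe)
    (forall₂_congr fun _ _ => step_mem_r_iff)

theorem measurableSet_cylinder (s : Finset (SampleWord R I × X)) (b : SampleWord R I × X → Bool)
    (t : Finset (SampleWord R I × R)) (y : SampleWord R I × R → I) :
    MeasurableSet (B.cylinder i s b t y) := by
  simp only [cylinder, Set.ofPred_and, Set.ofPred_forall]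
  exact (s.measurableSet_biInter fun d _ =>
      (measurableSet_outcome y (.inl d)).iff (.const (b d = true))).inter
    (t.measurableSet_biInter fun d _ => measurableSet_outcome y (.inr d))

variable (B i) in
theorem exists_isSamplingLaw : ∃ P : Measure (B.Sampling i), B.IsSamplingLaw i P := by
  let _ : MeasurableSpace I := ⊤
  refine ⟨((independentRolls (B.coin i)).prod (independentRolls (B.successor i))).map
    Rolls.sampling, fun s b t y => ?_⟩
  rw [map_measureReal_apply Rolls.measurable_sampling (measurableSet_cylinder s b t y),
    Rolls.preimage_cylinder, measureReal_prod_prod]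
  simp only [Measure.real, independentRolls_forall_eq, ENNReal.toReal_prod, toReal_coin]
  rfl

end AleatoricStructure

theorem mainTheorem2_general {X R : Type*} :
    ∃ star : ALC X R → ADL X R,
      (∀ (α : ALC X R) {J : Type*} (M : Interp X R J) (hM : M.Functional) (j : J),
        M.Sat α j ↔ (M.toAleatoric hM).eval (star α) j = 1) ∧
      ∀ {I : Type*} (B : AleatoricStructure X R I) (i : I),
        ∃ P : Measure (B.Sampling i),
          IsProbabilityMeasure P ∧
          B.IsSamplingLaw i P ∧
          (∀ β : ALC X R, MeasurableSet (B.hat i β)) ∧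
          ∀ α : ALC X R, P.real (B.hat i α) = B.eval (star α) i := by
  refine ⟨ALC.toADL, fun α _ _ hM j => hM.sat_iff_eval_toADL α j, fun B i => ?_⟩
  obtain ⟨P, hP⟩ := B.exists_isSamplingLaw i
  exact ⟨P, hP.isProbabilityMeasure, hP, B.measurableSet_hat i, hP.real_hat⟩

theorem mainTheorem2 {X R : Type*} (idr : R) :
    ∃ star : ALC X R → ADL X R,
      (∀ (α : ALC X R) {J : Type*} (M : Interp X R J) (hM : M.Functional) (j : J),
        M.Sat α j ↔ (M.toAleatoric hM).eval (star α) j = 1) ∧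
      ∀ {I : Type*} (B : BeliefModel X R idr I) (i : I),
        ∃ P : Measure (B.Sampling i),
          IsProbabilityMeasure P ∧
          B.IsSamplingLaw i P ∧
          (∀ β : ALC X R, MeasurableSet (B.hat i β)) ∧
          ∀ α : ALC X R, P.real (B.hat i α) = B.eval (star α) i := by
  obtain ⟨star, hequiv, hlaw⟩ := mainTheorem2_general (X := X) (R := R)
  exact ⟨star, hequiv, fun B i => hlaw B.toAleatoricStructure i⟩
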